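/- Let $\mathcal A$ be any (not necessarily unital) $C^*$-algebra and let $\mathcal M,\mathcal N$ be right Hilbert $C^*$-modules over $\mathcal A$, with $\mathcal A$-valued inner products $\langle\cdot,\cdot\rangle$ that are linear in the second variable and satisfy $\langle x,ya\rangle=\langle x,y\rangle a$. Suppose that $\mathcal N$ is countably generated, i.e. the finite $\mathcal A$-linear combinations of the elements of some countable subset are dense in $\mathcal N$. Let $F:\mathcal M\to\mathcal N$ be an adjointable operator, that is, a bounded $\mathcal A$-homomorphism for which there is a bounded operator $F^*:\mathcal N\to\mathcal M$ with $\langle Fx,y\rangle=\langle x,F^*y\rangle$ for all $x\in\mathcal M$, $y\in\mathcal N$, and let $B=\{x\in\mathcal M:\|x\|\le 1\}$ be the unit ball of $\mathcal M$. Then the following are equivalent. (1) $F$ is $\mathcal A$-compact, i.e. $F$ lies in the operator-norm closure of the linear span of the operators $\theta_{x,y}:\mathcal M\to\mathcal N$, $\theta_{x,y}(z)=x\langle y,z\rangle$, with $x\in\mathcal N$, $y\in\mathcal M$. (2) $F(B)$ is totally bounded in the following sense. For every sequence $X=(x_i)_{i\ge1}$ in $\mathcal N$ that is admissible (for every $x\in\mathcal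 N$ the partial sums of the series $\sum_i\langle x,x_i\rangle\langle x_i,x\rangle$ are bounded above by $\langle x,x\rangle$ and the series converges in norm), every sequence $\Phi=(\varphi_k)_{k\ge1}$ of states on $\mathcal A$ (positive linear functionals of norm one) and every $\varepsilon>0$, there are finitely many $y_1,\dots,y_n\in F(B)$ such that for each $y\in F(B)$ some $j$ satisfies $d_{X,\Phi}(y_j,y)<\varepsilon$, where $$d_{X,\Phi}(u,v)^2=\sup_k\sum_{i=k}^{\infty}\bigl|\varphi_k(\langle u-v,x_i\rangle)\bigr|^2 .$$ -/

import Mathlib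

open scoped RightActions

/-! A right Hilbert `A`-module `E` is Mathlib's `CStarModule` over the opposite C*-algebra `Aᵐᵒᵖ`
(together with completeness of `E`): `Aᵐᵒᵖ` acts on `E`, i.e. `A` acts on the right, and
`x <• a` is the notation for `MulOpposite.op a • x`. The `Aᵐᵒᵖ`-valued inner product is read in
`A` through `rightInner` below, for which the usual laws of a right module hold:
it is conjugate linear in the first variable, linear in the second one, and
`⟨x, y <• a⟩ = ⟨x, y⟩ * a`. -/

set_option linter.unusedSectionVars false

namespace HilbertCStar

section Modules

variable (A : Type*) [NonUnitalCStarAlgebra A] [PartialOrder A] [StarOrderedRing A]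
variable {E : Type*} [NormedAddCommGroup E] [NormedSpace ℂ E] [SMul Aᵐᵒᵖ E] [CStarModule Aᵐᵒᵖ E]

/-- The `A`-valued inner product of a right Hilbert `A`-module. -/
noncomputable def rightInner (x y : E) : A := MulOpposite.unop (inner Aᵐᵒᵖ x y)

theorem op_rightInner (x y : E) : MulOpposite.op (rightInner A x y) = inner Aᵐᵒᵖ x y := rfl

theorem rightInner_self_nonneg (x : E) : 0 ≤ rightInner A x x :=
  CStarModule.inner_self_nonneg (A := Aᵐᵒᵖ) (x := x)

theorem rightInner_self_eq_zero (x : E) : rightInner A x x = 0 ↔ x = 0 := by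
  rw [← CStarModule.inner_self (A := Aᵐᵒᵖ) (x := x), ← op_rightInner A x x,
    MulOpposite.op_eq_zero_iff]

theorem rightInner_add (x y z : E) :
    rightInner A x (y + z) = rightInner A x y + rightInner A x z := by
  simp [rightInner]

theorem rightInner_smul (c : ℂ) (x y : E) :
    rightInner A x (c • y) = c • rightInner A x y := by
  simp [rightInner]

theorem rightInner_sub (x y z : E) :
    rightInner A x (y - z) = rightInner A x y - rightInner A x z := by
  simp [rightInner]

theorem star_rightInner (x y : E) : star (rightInner A x y) = rightInner A y x := by
  have h := CStarModule.star_inner (A := Aᵐᵒᵖ) x y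
  simp only [← op_rightInner] at h
  exact MulOpposite.op_injective h

theorem rightInner_op_smul (x y : E) (a : A) :
    rightInner A x (y <• a) = rightInner A x y * a := by
  simp [rightInner]

theorem norm_sq_eq_norm_rightInner (x : E) : ‖x‖ ^ 2 = ‖rightInner A x x‖ :=
  CStarModule.norm_sq_eq Aᵐᵒᵖ

theorem norm_rightInner_le (x y : E) : ‖rightInner A x y‖ ≤ ‖x‖ * ‖y‖ :=
  CStarModule.norm_inner_le (A := Aᵐᵒᵖ) E

theorem ext_rightInner {x y : E} (h : ∀ z : E, rightInner A z x = rightInner A z y) :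
    x = y := by
  rw [← sub_eq_zero, ← rightInner_self_eq_zero A, rightInner_sub, h, sub_self]

theorem op_smul_add_right (x : E) (a b : A) : x <• (a + b) = x <• a + x <• b :=
  ext_rightInner A fun z => by
    rw [rightInner_add, rightInner_op_smul, rightInner_op_smul, rightInner_op_smul, mul_add]

theorem op_smul_smul_right (c : ℂ) (x : E) (a : A) : x <• (c • a) = c • (x <• a) :=
  ext_rightInner A fun z => by
    rw [rightInner_smul, rightInner_op_smul, rightInner_op_smul, mul_smul_comm]

theorem norm_op_smul_le (x : E) (a : A) : ‖x <• a‖ ≤ ‖x‖ * ‖a‖ := by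
  have h : rightInner A (x <• a) (x <• a) = star a * rightInner A x x * a := by
    rw [rightInner_op_smul, ← star_rightInner A x (x <• a), rightInner_op_smul, star_mul,
      star_rightInner]
  refine le_of_sq_le_sq ?_ (by positivity)
  rw [norm_sq_eq_norm_rightInner A, h]
  calc ‖star a * rightInner A x x * a‖ ≤ ‖star a‖ * ‖rightInner A x x‖ * ‖a‖ :=
        (norm_mul_le _ _).trans (by gcongr; exact norm_mul_le _ _)
    _ = (‖x‖ * ‖a‖) ^ 2 := by
        rw [norm_star, ← norm_sq_eq_norm_rightInner A]; ring

variable {M N : Type*} [NormedAddCommGroup M] [NormedSpace ℂ M] [SMul Aᵐᵒᵖ M] [CStarModule Aᵐᵒᵖ M]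
  [NormedAddCommGroup N] [NormedSpace ℂ N] [SMul Aᵐᵒᵖ N] [CStarModule Aᵐᵒᵖ N]

/-- The elementary operator `θ_{x,y} : M → N`, `θ_{x,y}(z) = x ⟨y, z⟩`. -/
noncomputable def theta (x : N) (y : M) : M →L[ℂ] N :=
  LinearMap.mkContinuous
    { toFun := fun z => x <• rightInner A y z
      map_add' := fun z w => by rw [rightInner_add, op_smul_add_right]
      map_smul' := fun c z => by rw [rightInner_smul, op_smul_smul_right, RingHom.id_apply] }
    (‖x‖ * ‖y‖) fun z =>
      calc ‖x <• rightInner A y z‖ ≤ ‖x‖ * ‖rightInner A y z‖ := norm_op_smul_le A x _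
        _ ≤ ‖x‖ * (‖y‖ * ‖z‖) := by gcongr; exact norm_rightInner_le A y z
        _ = ‖x‖ * ‖y‖ * ‖z‖ := (mul_assoc _ _ _).symm

theorem theta_apply (x : N) (y z : M) : theta A x y z = x <• rightInner A y z := rfl

/-- `F` has an adjoint with respect to the `A`-valued inner products. -/
def IsAdjointable (F : M →L[ℂ] N) : Prop :=
  ∃ G : N →L[ℂ] M, ∀ (x : M) (y : N), rightInner A (F x) y = rightInner A x (G y)

/-- Adjointable operators are homomorphisms of right `A`-modules. -/
theorem IsAdjointable.map_op_smul {F : M →L[ℂ] N} (hF : IsAdjointable A F) (x : M) (a : A) :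
    F (x <• a) = F x <• a := by
  obtain ⟨G, hG⟩ := hF
  have hG' : ∀ (z : N) (w : M), rightInner A z (F w) = rightInner A (G z) w := fun z w => by
    rw [← star_rightInner A (F w) z, hG, star_rightInner]
  exact ext_rightInner A fun z => by
    rw [hG', rightInner_op_smul, rightInner_op_smul, hG']

/-- `F` is `A`-compact: an operator norm limit of finite linear combinations of the elementary
operators `θ_{x,y}`. -/
def IsACompact (F : M →L[ℂ] N) : Prop :=
  F ∈ closure (Submodule.span ℂ {T : M →L[ℂ] N | ∃ (x : N) (y : M), T = theta A x y} :
    Set (M →L[ℂ] N))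

variable (N) in
/-- `N` is countably generated: the (finite) `A`-linear combinations of the elements of some
countable set are dense in `N`. -/
def IsCountablyGenerated : Prop :=
  ∃ S : Set N, S.Countable ∧
    Dense (Submodule.span ℂ {z : N | ∃ s ∈ S, ∃ a : A, z = s <• a} : Set N)

/-- The system `X` is admissible (for `N`): for each `x ∈ N` the partial sums of the series
`∑ᵢ ⟨x, xᵢ⟩⟨xᵢ, x⟩` are bounded by `⟨x, x⟩`, and the series converges in norm. -/
def IsAdmissible (X : ℕ → N) : Prop :=
  ∀ x : N,
    (∀ n : ℕ, ∑ i ∈ Finset.range n, rightInner A x (X i) * rightInner A (X i) x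
      ≤ rightInner A x x) ∧
    ∃ s : A, Filter.Tendsto
      (fun n : ℕ => ∑ i ∈ Finset.range n, rightInner A x (X i) * rightInner A (X i) x)
      Filter.atTop (nhds s)

variable {A}

/-- A state on `A`: a positive linear functional of norm one. -/
def IsState (φ : A →L[ℂ] ℂ) : Prop :=
  (∀ a : A, 0 ≤ a → ∃ r : ℝ, 0 ≤ r ∧ φ a = (r : ℂ)) ∧ ‖φ‖ = 1

/-- The pseudo-metric `d_{X,Φ}`, where
`d_{X,Φ}(x, y)² = sup_k ∑_{i ≥ k} |φ_k(⟨x - y, x_i⟩)|²`.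
The supremum and the sum of the series are taken in `[0, ∞]`, so that they always have
their genuine values; for admissible `X` and states `φ_k`, `d_{X,Φ}(x, y)` is at most `‖x - y‖`. -/
noncomputable def pseudoDist (X : ℕ → N) (Φ : ℕ → A →L[ℂ] ℂ) (x y : N) : ENNReal :=
  (⨆ k : ℕ, ∑' i : {i : ℕ // k ≤ i}, ‖Φ k (rightInner A (x - y) (X i))‖ₑ ^ 2) ^ (1 / 2 : ℝ)

variable (A) in
/-- `Y ⊆ N` is totally bounded for the uniform structure given by all the `d_{X,Φ}` with `X`
admissible and `Φ` a sequence of states: for each `d_{X,Φ}` and `ε > 0`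
there is a finite `ε`-net in `Y`. -/
def IsTotallyBounded (Y : Set N) : Prop :=
  ∀ (X : ℕ → N) (Φ : ℕ → A →L[ℂ] ℂ), IsAdmissible A X → (∀ k, IsState (Φ k)) →
    ∀ ε : ℝ, 0 < ε → ∃ T : Set N, T.Finite ∧ T ⊆ Y ∧
      ∀ y ∈ Y, ∃ t ∈ T, pseudoDist X Φ t y < ENNReal.ofReal ε

end Modules

end HilbertCStar

open HilbertCStar

/-!
The idea is to test operators `F : M → N` against the tails of `∑ᵢ |φ(⟨F z, xᵢ⟩)|²`, uniformly in
the state `φ` and in `z` in the unit ball.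

If `F` is `A`-compact, these tails tend to zero for every admissible `X`. Indeed, the operators with
this property form a closed subspace (`uniformTailOperators`) which contains each `θ_{x,y}`, since
`|φ(a⋆ ⟨x, xᵢ⟩)|² ≤ φ(a⋆ ⟨x, xᵢ⟩⟨xᵢ, x⟩ a)` by the Kadison–Schwarz inequality
(`IsState.norm_sq_le`) and since `∑ᵢ ⟨x, xᵢ⟩⟨xᵢ, x⟩` converges in norm. As the `k`-th term of
`d_{X,Φ}` only involves indices `i ≥ k`, uniform tails leave finitely many coordinates
`φₖ(⟨·, xᵢ⟩)`, `i, k < m`, and a bounded set of these is totally bounded.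

For the converse, scaled generators `tᵢ` of `N` give an `A`-compact positive contraction
`h = ∑ᵢ θ_{tᵢ,tᵢ}`. With `r = 1 - h`, the operators `1 - rⁿ` are an increasing sequence of
`A`-compact operators, and they tend strongly to `1`: the powers of `r` are positive and decreasing,
a telescoping sum gives `rⁿ h ≤ 1 / (n + 1)`, and `θ_{tᵢ,tᵢ} ≤ h` then forces `rⁿ tᵢ → 0`
(`IsPosContraction.tendsto_one_sub_pow_apply`). Only polynomials in `h` occur, so no functional
calculus for adjointable operators is needed. If `F` is not `A`-compact, then `‖rⁿ F‖` is bounded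
below, and there are disjoint blocks `qᵢ = r^{νᵢ} - r^{νᵢ₊₁}` and `yᵢ` in the image of the unit ball
with `‖⟨yᵢ, qᵢ yᵢ⟩‖` bounded below. After scaling, the vectors `xᵢ = qᵢ yᵢ` are admissible
(`IsPosContraction.isAdmissible_pow_sub_pow`), and there are states `φᵢ` attaining the norms of the
positive elements `⟨yᵢ, qᵢ yᵢ⟩` (`exists_isState_apply_eq_norm`). Thus `|φᵢ(⟨yᵢ, xᵢ⟩)|` is bounded
below, whereas `⟨t, xᵢ⟩ → 0` for every single `t`, so that no finite set is a net for the `yᵢ`.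
-/

namespace HilbertCStar

/-! ### States -/

section States

open scoped ComplexOrder
open Unitization

theorem norm_one_add_of_nonneg {B : Type*} [CStarAlgebra B] [PartialOrder B] [StarOrderedRing B]
    [Nontrivial B] {a : B} (ha : 0 ≤ a) : ‖1 + a‖ = 1 + ‖a‖ := by
  refine le_antisymm ((norm_add_le _ _).trans_eq (by rw [norm_one])) ?_
  have h := CStarAlgebra.norm_mem_spectrum_of_nonneg ha
  have h1 : 1 + ‖a‖ ∈ spectrum ℝ (1 + a) := by
    have := (spectrum.add_mem_add_iff (R := ℝ) (a := a) (r := ‖a‖) (s := 1)).2 h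
    simpa [add_comm] using this
  have h2 := spectrum.norm_le_norm_of_mem h1
  rwa [Real.norm_of_nonneg (by positivity)] at h2

/-- A contractive functional on a unital C⋆-algebra that takes the value `1` at the unit is
positive. -/
theorem nonneg_of_norm_le_one_of_map_one {B : Type*} [CStarAlgebra B] [PartialOrder B]
    [StarOrderedRing B] (g : B →L[ℂ] ℂ) (hg : ‖g‖ ≤ 1) (hg1 : g 1 = 1) {b : B} (hb : 0 ≤ b) :
    0 ≤ g b := by
  have hle (c : B) : ‖g c‖ ≤ ‖c‖ := (g.le_of_opNorm_le hg c).trans_eq (one_mul _)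
  have hsa : IsSelfAdjoint b := .of_nonneg hb
  have halg (s : ℝ) : g (algebraMap ℝ B s) = s := by
    rw [Algebra.algebraMap_eq_smul_one, ← Complex.coe_smul, map_smul, hg1]; simp
  -- `‖b‖ - b` has norm at most `‖b‖`, so `g b` is within `‖b‖` of `‖b‖` and has real part `≥ 0`;
  -- `‖b + i t‖² ≤ ‖b‖² + t²` for all real `t` makes its imaginary part vanish
  refine Complex.nonneg_iff.2 ⟨?_, ?_⟩
  · have h1 : ‖algebraMap ℝ B ‖b‖ - b‖ ≤ ‖b‖ := by
      rw [CStarAlgebra.norm_le_iff_le_algebraMap _ (norm_nonneg b)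
        (sub_nonneg.2 hsa.le_algebraMap_norm_self)]
      exact sub_le_self _ hb
    have h2 := (hle _).trans h1
    rw [map_sub, halg] at h2
    have h3 := (Complex.re_le_norm _).trans h2
    simp at h3
    exact h3
  · have key (t : ℝ) : ((g b).im + t) ^ 2 ≤ ‖b‖ ^ 2 + t ^ 2 := by
      have h1 : star (b + (Complex.I * t) • (1 : B)) * (b + (Complex.I * t) • (1 : B))
          = b * b + algebraMap ℝ B (t ^ 2) := by
        rw [Algebra.algebraMap_eq_smul_one, ← Complex.coe_smul]
        simp only [star_add, hsa.star_eq, star_smul, star_one, mul_add, add_mul, smul_mul_assoc,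
          mul_smul_comm, one_mul, mul_one, smul_add, smul_smul, star_mul',
          Complex.star_def, Complex.conj_I, Complex.conj_ofReal]
        rw [show Complex.I * (t : ℂ) * (-Complex.I * t) = ((t ^ 2 : ℝ) : ℂ) by
          push_cast; linear_combination (-(t : ℂ) ^ 2) * Complex.I_mul_I]
        rw [neg_mul, neg_smul]
        abel
      have h2 : ‖b + (Complex.I * t) • (1 : B)‖ ^ 2 ≤ ‖b‖ ^ 2 + t ^ 2 := by
        rw [pow_two, ← CStarRing.norm_star_mul_self, h1]
        refine (norm_add_le _ _).trans (add_le_add ((norm_mul_le _ _).trans_eq (pow_two _).symm) ?_)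
        rcases subsingleton_or_nontrivial B with hB | hB
        · rw [Subsingleton.elim (algebraMap ℝ B (t ^ 2)) 0, norm_zero]; positivity
        · rw [norm_algebraMap', Real.norm_of_nonneg (by positivity)]
      refine le_trans ?_ ((pow_le_pow_left₀ (norm_nonneg _) (hle _) 2).trans h2)
      rw [map_add, map_smul, hg1]
      have := Complex.abs_im_le_norm (g b + (Complex.I * t) • (1 : ℂ))
      simp only [smul_eq_mul, mul_one, Complex.add_im, Complex.mul_im, Complex.I_re, Complex.I_im,
        Complex.ofReal_re, Complex.ofReal_im, zero_mul, one_mul, zero_add] at this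
      rw [← sq_abs]
      simpa only [smul_eq_mul, mul_one] using pow_le_pow_left₀ (abs_nonneg _) this 2
    by_contra! hne
    have hne : (g b).im ≠ 0 := fun h => hne h.symm
    have := key ((‖b‖ ^ 2 + 1) / (g b).im)
    have h3 : (g b).im * ((‖b‖ ^ 2 + 1) / (g b).im) = ‖b‖ ^ 2 + 1 := by field_simp
    nlinarith [sq_nonneg (g b).im, sq_nonneg ‖b‖]

variable {A : Type*} [NonUnitalCStarAlgebra A] [PartialOrder A] [StarOrderedRing A]

/-- Every positive element attains its norm at some state. The Hahn–Banach functional that norms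
`1 + a` in the unitization has to take the values `1` at `1` and `‖a‖` at `a`, and so restricts to
a state. -/
theorem exists_isState_apply_eq_norm {a : A} (ha : 0 ≤ a) (ha0 : a ≠ 0) :
    ∃ φ : A →L[ℂ] ℂ, IsState φ ∧ φ a = ‖a‖ := by
  have hn : ‖(1 : Unitization ℂ A) + a‖ = 1 + ‖a‖ := by
    rw [norm_one_add_of_nonneg (inr_nonneg_iff.2 ha), norm_inr]
  obtain ⟨g, hg, hga⟩ := exists_dual_vector'' ℂ ((1 : Unitization ℂ A) + a)
  have hle (c : Unitization ℂ A) : ‖g c‖ ≤ ‖c‖ := (g.le_of_opNorm_le hg c).trans_eq (one_mul _)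
  rw [hn, map_add] at hga
  have h1 : ‖g 1‖ ≤ 1 := (hle 1).trans_eq norm_one
  have h2 : ‖g (a : Unitization ℂ A)‖ ≤ ‖a‖ := (hle _).trans_eq (norm_inr _)
  have aux {z : ℂ} {r : ℝ} (hz : ‖z‖ ≤ r) (hr : r ≤ z.re) : z = r := by
    have h3 : z.re = r := le_antisymm ((Complex.re_le_norm z).trans hz) hr
    have h4 := Complex.sq_norm_sub_sq_re z
    have h5 := pow_le_pow_left₀ (norm_nonneg z) hz 2
    rw [h3] at h4
    have h6 : z.im = 0 := by
      have : z.im ^ 2 ≤ 0 := by linarith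
      exact pow_eq_zero_iff two_ne_zero |>.1 (le_antisymm this (sq_nonneg _))
    apply Complex.ext <;> simp [h3, h6]
  have hre : (g 1).re + (g (a : Unitization ℂ A)).re = 1 + ‖a‖ := by
    have := congrArg Complex.re hga
    simpa using this
  have h1' := (Complex.re_le_norm _).trans h1
  have h2' := (Complex.re_le_norm _).trans h2
  have hg1 : g 1 = 1 := by
    have := aux h1 (by linarith)
    simpa using this
  have hg2 : g (a : Unitization ℂ A) = ‖a‖ := aux h2 (by linarith)
  let φ : A →L[ℂ] ℂ := LinearMap.mkContinuous
    (g.toLinearMap ∘ₗ Unitization.inrHom ℂ ℂ A) 1 fun x => by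
      simpa using (hle (x : Unitization ℂ A)).trans_eq (norm_inr _)
  have hφ (x : A) : φ x = g (x : Unitization ℂ A) := rfl
  refine ⟨φ, ⟨fun b hb => ?_, le_antisymm (LinearMap.mkContinuous_norm_le _ zero_le_one _) ?_⟩,
    (hφ a).trans hg2⟩
  · have h := nonneg_of_norm_le_one_of_map_one g hg hg1 (inr_nonneg_iff.2 hb)
    exact ⟨(g b).re, (Complex.nonneg_iff.1 h).1, by
      rw [hφ]; exact Complex.ext rfl (by simpa using (Complex.nonneg_iff.1 h).2.symm)⟩
  · have h := φ.le_opNorm a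
    rw [hφ, hg2, Complex.norm_real, norm_norm] at h
    exact le_of_mul_le_mul_right (by simpa using h) (norm_pos_iff.2 ha0)

theorem IsState.nonneg {φ : A →L[ℂ] ℂ} (hφ : IsState φ) {a : A} (ha : 0 ≤ a) : 0 ≤ φ a := by
  obtain ⟨r, hr, h⟩ := hφ.1 a ha
  rw [h]; exact_mod_cast hr

theorem IsState.norm_apply_le {φ : A →L[ℂ] ℂ} (hφ : IsState φ) (a : A) : ‖φ a‖ ≤ ‖a‖ :=
  (φ.le_of_opNorm_le hφ.2.le a).trans_eq (one_mul _)

/-- The Kadison–Schwarz inequality for states. Without a unit it follows from the Cauchy–Schwarz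
inequality for `⟨a⋆, e⟩ ↦ φ (a * e)`, with `e` running through an approximate unit. -/
theorem IsState.norm_sq_le {φ : A →L[ℂ] ℂ} (hφ : IsState φ) (a : A) :
    ‖φ a‖ ^ 2 ≤ (φ (a * star a)).re := by
  let f : A →ₚ[ℂ] ℂ := PositiveLinearMap.mk₀ φ.toLinearMap fun x hx => hφ.nonneg hx
  have hf (x : A) : f x = φ x := rfl
  have hcs (e : A) (he : ‖e‖ ≤ 1) : ‖φ (a * e)‖ ^ 2 ≤ (φ (a * star a)).re := by
    have h := norm_inner_le_norm (𝕜 := ℂ) (f.toPreGNS (star a)) (f.toPreGNS e)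
    have h1 : ‖f.toPreGNS (star a)‖ ^ 2 = (φ (a * star a)).re := by
      have := congrArg Complex.re (f.preGNS_norm_sq (f.toPreGNS (star a)))
      simpa [← Complex.ofReal_pow, hf] using this
    have h2 : ‖f.toPreGNS e‖ ^ 2 ≤ 1 := by
      have := congrArg Complex.re (f.preGNS_norm_sq (f.toPreGNS e))
      rw [← Complex.ofReal_pow, Complex.ofReal_re] at this
      rw [this, f.ofPreGNS_toPreGNS, hf]
      refine (Complex.re_le_norm _).trans ((hφ.norm_apply_le _).trans ?_)
      rw [CStarRing.norm_star_mul_self]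
      exact mul_le_one₀ he (norm_nonneg _) he
    rw [f.preGNS_inner_def, f.ofPreGNS_toPreGNS, f.ofPreGNS_toPreGNS, star_star, hf] at h
    calc ‖φ (a * e)‖ ^ 2 ≤ (‖f.toPreGNS (star a)‖ * ‖f.toPreGNS e‖) ^ 2 :=
          pow_le_pow_left₀ (norm_nonneg _) h 2
      _ = ‖f.toPreGNS (star a)‖ ^ 2 * ‖f.toPreGNS e‖ ^ 2 := mul_pow _ _ _
      _ ≤ ‖f.toPreGNS (star a)‖ ^ 2 * 1 := by gcongr
      _ = _ := by rw [mul_one, h1]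
  have hu := CStarAlgebra.increasingApproximateUnit A
  refine le_of_tendsto (f := fun e => ‖φ (a * e)‖ ^ 2) (x := CStarAlgebra.approximateUnit A) ?_
    (hu.eventually_norm.mono fun e he => hcs e he)
  exact (((φ.continuous.tendsto a).comp (hu.tendsto_mul_left a)).norm).pow 2

end States

/-! ### Inner products -/

section InnerProduct

variable (A : Type*) [NonUnitalCStarAlgebra A] [PartialOrder A] [StarOrderedRing A]
variable {E : Type*} [NormedAddCommGroup E] [NormedSpace ℂ E] [SMul Aᵐᵒᵖ E] [CStarModule Aᵐᵒᵖ E]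

theorem rightInner_sub_left (x y z : E) :
    rightInner A (x - y) z = rightInner A x z - rightInner A y z := by
  simp [rightInner]

theorem rightInner_add_left (x y z : E) :
    rightInner A (x + y) z = rightInner A x z + rightInner A y z := by
  simp [rightInner]

theorem rightInner_smul_left (c : ℂ) (x y : E) :
    rightInner A (c • x) y = star c • rightInner A x y := by
  simp [rightInner]

theorem rightInner_op_smul_left (x y : E) (a : A) :
    rightInner A (x <• a) y = star a * rightInner A x y := by
  simp [rightInner]

theorem continuous_rightInner : Continuous fun p : E × E => rightInner A p.1 p.2 :=
  MulOpposite.continuous_unop.comp (CStarModule.continuous_inner (A := Aᵐᵒᵖ))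

theorem rightInner_mul_swap_nonneg (x y : E) : 0 ≤ rightInner A x y * rightInner A y x := by
  rw [← star_rightInner A x y]
  exact mul_star_self_nonneg _

theorem rightInner_mul_swap_le (x y : E) :
    rightInner A x y * rightInner A y x ≤ ‖y‖ ^ 2 • rightInner A x x :=
  CStarModule.inner_mul_inner_swap_le (A := Aᵐᵒᵖ) (x := y) (y := x)

theorem norm_le_of_rightInner_self_le {x y : E} (h : rightInner A x x ≤ rightInner A y y) :
    ‖x‖ ≤ ‖y‖ := by
  refine le_of_sq_le_sq ?_ (norm_nonneg _)
  rw [norm_sq_eq_norm_rightInner A, norm_sq_eq_norm_rightInner A]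
  exact CStarAlgebra.norm_le_norm_of_nonneg_of_le (rightInner_self_nonneg A x) h

end InnerProduct

/-! ### Positive contractions -/

section PosContraction

variable (A : Type*) [NonUnitalCStarAlgebra A] [PartialOrder A] [StarOrderedRing A]
variable {N : Type*} [NormedAddCommGroup N] [NormedSpace ℂ N] [SMul Aᵐᵒᵖ N] [CStarModule Aᵐᵒᵖ N]

/-- `T` is a positive contraction of the Hilbert module `N`: it is self-adjoint and `0 ≤ T ≤ 1`,
where the order is the one given by the quadratic form `x ↦ ⟨x, T x⟩`. -/
structure IsPosContraction (T : N →L[ℂ] N) : Prop where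
  symm : ∀ x y, rightInner A (T x) y = rightInner A x (T y)
  nonneg : ∀ x, 0 ≤ rightInner A x (T x)
  le : ∀ x, rightInner A x (T x) ≤ rightInner A x x

namespace IsPosContraction

variable {A} {T h : N →L[ℂ] N}

theorem isAdjointable (hT : IsPosContraction A T) : IsAdjointable A T := ⟨T, hT.symm⟩

theorem one_sub (hT : IsPosContraction A T) : IsPosContraction A (1 - T) where
  symm x y := by
    simp only [sub_apply, one_apply_eq_self, rightInner_sub,
      rightInner_sub_left, hT.symm]
  nonneg x := by
    simpa [rightInner_sub] using hT.le x
  le x := by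
    simpa [rightInner_sub] using hT.nonneg x

/-- `T² ≤ T`, because `T - T² = T (1 - T) T + (1 - T) T (1 - T)`. -/
theorem rightInner_apply_self_le (hT : IsPosContraction A T) (x : N) :
    rightInner A (T x) (T x) ≤ rightInner A x (T x) := by
  have h1 := hT.one_sub.nonneg (T x)
  have h2 := hT.nonneg ((1 - T) x)
  have h3 : rightInner A x (T x) - rightInner A (T x) (T x)
      = rightInner A (T x) ((1 - T) (T x)) + rightInner A ((1 - T) x) (T ((1 - T) x)) := by
    simp only [sub_apply, one_apply_eq_self, rightInner_sub,
      rightInner_sub_left, map_sub, hT.symm]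
    abel
  rw [← sub_nonneg, h3]
  exact add_nonneg h1 h2

theorem norm_apply_le (hT : IsPosContraction A T) (x : N) : ‖T x‖ ≤ ‖x‖ :=
  norm_le_of_rightInner_self_le A ((hT.rightInner_apply_self_le x).trans (hT.le x))

theorem pow_symm (hT : IsPosContraction A T) (n : ℕ) (x y : N) :
    rightInner A ((T ^ n) x) y = rightInner A x ((T ^ n) y) := by
  induction n generalizing x y with
  | zero => rfl
  | succ n ih => rw [pow_succ, mul_apply_eq_comp, ih, hT.symm,
      ← mul_apply_eq_comp, ← pow_succ', pow_succ]

theorem rightInner_pow_add_two (hT : IsPosContraction A T) (n : ℕ) (x : N) :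
    rightInner A x ((T ^ (n + 2)) x) = rightInner A (T x) ((T ^ n) (T x)) := by
  rw [hT.symm, show n + 2 = 1 + n + 1 by omega, pow_succ, pow_add, pow_one]; rfl

theorem rightInner_pow_succ_le (hT : IsPosContraction A T) (n : ℕ) (x : N) :
    rightInner A x ((T ^ (n + 1)) x) ≤ rightInner A x ((T ^ n) x) := by
  induction n using Nat.twoStepInduction generalizing x with
  | zero => simpa using hT.le x
  | one =>
    rw [← hT.pow_symm]
    have := hT.rightInner_apply_self_le x
    rw [hT.symm] at this
    simpa [hT.symm, pow_two] using this
  | more n ih _ =>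
    rw [show n + 2 + 1 = n + 1 + 2 by omega, hT.rightInner_pow_add_two, hT.rightInner_pow_add_two]
    exact ih _

theorem rightInner_pow_antitone (hT : IsPosContraction A T) (x : N) :
    Antitone fun n : ℕ => rightInner A x ((T ^ n) x) :=
  antitone_nat_of_succ_le fun n => hT.rightInner_pow_succ_le n x

theorem pow (hT : IsPosContraction A T) (n : ℕ) : IsPosContraction A (T ^ n) where
  symm := hT.pow_symm n
  nonneg x := by
    induction n using Nat.twoStepInduction generalizing x with
    | zero => simpa using rightInner_self_nonneg A x
    | one => simpa using hT.nonneg x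
    | more n ih _ => rw [hT.rightInner_pow_add_two]; exact ih _
  le x := by simpa using hT.rightInner_pow_antitone x (Nat.zero_le n)

/-- Differences of powers of a positive contraction are positive contractions. -/
theorem pow_sub_pow (hT : IsPosContraction A T) {m n : ℕ} (hmn : m ≤ n) :
    IsPosContraction A (T ^ m - T ^ n) where
  symm x y := by
    simp only [sub_apply, rightInner_sub, rightInner_sub_left, hT.pow_symm]
  nonneg x := by
    rw [sub_apply, rightInner_sub, sub_nonneg]
    exact hT.rightInner_pow_antitone x hmn
  le x := by
    rw [sub_apply, rightInner_sub]
    exact (sub_le_self _ ((hT.pow n).nonneg x)).trans ((hT.pow m).le x)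

/-- The operator form of `t (1 - t)ⁿ ≤ 1 / (n + 1)` on `[0, 1]`, for `t = 1 - T`: the terms
`Tⁿ (1 - T)` decrease in `n`, and their partial sums telescope to at most `1`. -/
theorem norm_rightInner_pow_sub_pow_succ_le (hT : IsPosContraction A T) (n : ℕ) (x : N) :
    (n + 1) * ‖rightInner A x ((T ^ n - T ^ (n + 1)) x)‖ ≤ ‖x‖ ^ 2 := by
  set b : ℕ → A := fun n => rightInner A x ((T ^ n) x) with hb
  have hab (n : ℕ) : rightInner A x ((T ^ n - T ^ (n + 1)) x) = b n - b (n + 1) := by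
    rw [sub_apply, rightInner_sub]
  have hdec (n : ℕ) : b (n + 1) - b (n + 2) ≤ b n - b (n + 1) := by
    have h1 := (hT.pow n).nonneg ((1 - T) x)
    have h2 : rightInner A ((1 - T) x) ((T ^ n) ((1 - T) x))
        = (b n - b (n + 1)) - (b (n + 1) - b (n + 2)) := by
      have h3 : rightInner A (T x) ((T ^ n) x) = b (n + 1) := by
        rw [hT.symm]; simp only [hb]; rw [pow_succ']; rfl
      have h4 : rightInner A x ((T ^ n) (T x)) = b (n + 1) := by
        simp only [hb]; rw [pow_succ]; rfl
      simp only [sub_apply, one_apply_eq_self, rightInner_sub,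
        rightInner_sub_left, map_sub, h3, h4, ← hT.rightInner_pow_add_two]
      abel
    rwa [h2, sub_nonneg] at h1
  have hsum (n : ℕ) : (n + 1) • (b n - b (n + 1)) ≤ b 0 - b (n + 1) := by
    induction n with
    | zero => simp
    | succ n ih =>
      rw [succ_nsmul]
      calc (n + 1) • (b (n + 1) - b (n + 2)) + (b (n + 1) - b (n + 2))
          ≤ (n + 1) • (b n - b (n + 1)) + (b (n + 1) - b (n + 2)) := by
            exact add_le_add_left (nsmul_le_nsmul_right (hdec n) _) _
        _ ≤ (b 0 - b (n + 1)) + (b (n + 1) - b (n + 2)) := by gcongr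
        _ = b 0 - b (n + 2) := by abel
  have hpos : 0 ≤ b n - b (n + 1) := sub_nonneg.2 (hT.rightInner_pow_succ_le n x)
  have h1 : (n + 1) • (b n - b (n + 1)) ≤ rightInner A x x :=
    (hsum n).trans (sub_le_self _ ((hT.pow _).nonneg x))
  have h2 := CStarAlgebra.norm_le_norm_of_nonneg_of_le (nsmul_nonneg hpos _) h1
  rw [← norm_sq_eq_norm_rightInner A, RCLike.norm_nsmul ℂ] at h2
  rw [hab]
  rwa [nsmul_eq_mul, Nat.cast_add_one] at h2

open Filter in
/-- If `θ_{t,t} ≤ h`, then the powers of `1 - h` annihilate `t` in the limit. -/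
theorem tendsto_one_sub_pow_apply (hh : IsPosContraction A h) {t : N}
    (ht : ∀ y, rightInner A y t * rightInner A t y ≤ rightInner A y (h y)) :
    Tendsto (fun n : ℕ => ((1 - h) ^ n) t) atTop (nhds 0) := by
  set r := 1 - h with hr
  have hrp : IsPosContraction A r := hh.one_sub
  have hbound (n : ℕ) (x : N) : (n + 1) * ‖rightInner A x ((r ^ n) t)‖ ^ 2 ≤ ‖x‖ ^ 2 := by
    have h1 := ht ((r ^ n) x)
    have h2 : rightInner A ((r ^ n) x) (h ((r ^ n) x))
        = rightInner A x ((r ^ (2 * n) - r ^ (2 * n + 1)) x) := by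
      have : r ^ (2 * n) - r ^ (2 * n + 1) = r ^ n * (h * r ^ n) := by
        have hhr : h = 1 - r := by rw [hr]; abel
        rw [hhr, sub_mul, mul_sub, one_mul, ← pow_succ', ← pow_add, ← pow_add]
        congr 2 <;> ring
      rw [this, hrp.pow_symm]; rfl
    have h3 := CStarAlgebra.norm_le_norm_of_nonneg_of_le (rightInner_mul_swap_nonneg A _ _) h1
    rw [h2, ← star_rightInner A ((r ^ n) x) t, CStarRing.norm_self_mul_star, hrp.pow_symm,
      ← pow_two] at h3
    have h4 := hrp.norm_rightInner_pow_sub_pow_succ_le (2 * n) x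
    rw [Nat.cast_mul, Nat.cast_two] at h4
    have h5 : 0 ≤ ‖rightInner A x ((r ^ (2 * n) - r ^ (2 * n + 1)) x)‖ := norm_nonneg _
    have h6 : (0 : ℝ) ≤ n := n.cast_nonneg
    nlinarith
  -- the bound at `x = rⁿ t` gives `(n + 1) ‖rⁿ t‖⁴ ≤ ‖rⁿ t‖²`
  have hsq (n : ℕ) : ‖(r ^ n) t‖ ^ 2 ≤ 1 / ((n : ℝ) + 1) := by
    have h1 := hbound n ((r ^ n) t)
    rw [← norm_sq_eq_norm_rightInner A] at h1
    rcases eq_or_lt_of_le (sq_nonneg ‖(r ^ n) t‖) with h0 | h0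
    · rw [← h0]; positivity
    · rw [le_div_iff₀ (by positivity)]
      nlinarith
  have h1 : Tendsto (fun n : ℕ => ‖(r ^ n) t‖ ^ 2) atTop (nhds 0) :=
    squeeze_zero (fun n => sq_nonneg _) hsq tendsto_one_div_add_atTop_nhds_zero_nat
  rw [tendsto_zero_iff_norm_tendsto_zero]
  have h2 := h1.sqrt
  simpa [Real.sqrt_sq (norm_nonneg _)] using h2

end IsPosContraction

end PosContraction

/-! ### Compact operators -/

section Compact

variable (A : Type*) [NonUnitalCStarAlgebra A] [PartialOrder A] [StarOrderedRing A]
variable {L M N : Type*}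
  [NormedAddCommGroup L] [NormedSpace ℂ L] [SMul Aᵐᵒᵖ L] [CStarModule Aᵐᵒᵖ L]
  [NormedAddCommGroup M] [NormedSpace ℂ M] [SMul Aᵐᵒᵖ M] [CStarModule Aᵐᵒᵖ M]
  [NormedAddCommGroup N] [NormedSpace ℂ N] [SMul Aᵐᵒᵖ N] [CStarModule Aᵐᵒᵖ N]

theorem norm_theta_le (x : N) (y : M) : ‖theta A x y‖ ≤ ‖x‖ * ‖y‖ :=
  LinearMap.mkContinuous_norm_le _ (by positivity) _

theorem rightInner_theta (x w : N) (y z : M) :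
    rightInner A w (theta A x y z) = rightInner A w x * rightInner A y z := by
  rw [theta_apply, rightInner_op_smul]

variable (M N) in
/-- The `A`-compact operators as a closed subspace of the bounded operators. -/
noncomputable def compactOperators : Submodule ℂ (M →L[ℂ] N) :=
  (Submodule.span ℂ {T : M →L[ℂ] N | ∃ (x : N) (y : M), T = theta A x y}).topologicalClosure

variable {A}

theorem mem_compactOperators {F : M →L[ℂ] N} : F ∈ compactOperators A M N ↔ IsACompact A F :=
  Iff.rfl

theorem theta_mem_compactOperators (x : N) (y : M) : theta A x y ∈ compactOperators A M N :=
  Submodule.le_topologicalClosure _ (Submodule.subset_span ⟨x, y, rfl⟩)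

/-- A closed subspace of bounded operators that contains all `θ_{x,y}` contains all `A`-compact
operators. -/
theorem compactOperators_le {V : Submodule ℂ (M →L[ℂ] N)} (hV : IsClosed (V : Set (M →L[ℂ] N)))
    (h : ∀ (x : N) (y : M), theta A x y ∈ V) : compactOperators A M N ≤ V := by
  refine Submodule.topologicalClosure_minimal _ (Submodule.span_le.2 ?_) hV
  rintro _ ⟨x, y, rfl⟩
  exact h x y

theorem isClosed_compactOperators : IsClosed (compactOperators A M N : Set (M →L[ℂ] N)) :=
  Submodule.isClosed_topologicalClosure _

theorem comp_mem_compactOperators {T : M →L[ℂ] N} (hT : T ∈ compactOperators A M N)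
    {F : L →L[ℂ] M} (hF : IsAdjointable A F) : T ∘L F ∈ compactOperators A L N := by
  obtain ⟨G, hG⟩ := hF
  let Φ : (M →L[ℂ] N) →L[ℂ] (L →L[ℂ] N) := (ContinuousLinearMap.compL ℂ L M N).flip F
  have h : compactOperators A M N ≤ (compactOperators A L N).comap Φ.toLinearMap := by
    refine compactOperators_le (isClosed_compactOperators.preimage Φ.continuous) fun x y => ?_
    have : theta A x y ∘L F = theta A x (G y) := by
      ext z
      rw [ContinuousLinearMap.comp_apply, theta_apply, theta_apply, ← star_rightInner A (F z) y, hG,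
        star_rightInner]
    change theta A x y ∘L F ∈ compactOperators A L N
    rw [this]
    exact theta_mem_compactOperators _ _
  exact h hT

theorem adjointable_comp_mem_compactOperators {T : L →L[ℂ] M} (hT : T ∈ compactOperators A L M)
    {F : M →L[ℂ] N} (hF : IsAdjointable A F) : F ∘L T ∈ compactOperators A L N := by
  let Φ : (L →L[ℂ] M) →L[ℂ] (L →L[ℂ] N) := ContinuousLinearMap.compL ℂ L M N F
  have h : compactOperators A L M ≤ (compactOperators A L N).comap Φ.toLinearMap := by
    refine compactOperators_le (isClosed_compactOperators.preimage Φ.continuous) fun x y => ?_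
    have : F ∘L theta A x y = theta A (F x) y := by
      ext z
      rw [ContinuousLinearMap.comp_apply, theta_apply, theta_apply, hF.map_op_smul]
    change F ∘L theta A x y ∈ compactOperators A L N
    rw [this]
    exact theta_mem_compactOperators _ _
  exact h hT

/-- If `h` is `A`-compact, then so is `(1 - (1 - h)ⁿ) F`. -/
theorem sub_one_sub_pow_comp_mem {h : N →L[ℂ] N} (hh : IsPosContraction A h)
    (hc : h ∈ compactOperators A N N) {F : M →L[ℂ] N} (hF : IsAdjointable A F) (n : ℕ) :
    F - ((1 - h) ^ n) ∘L F ∈ compactOperators A M N := by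
  induction n with
  | zero =>
    rw [pow_zero, ContinuousLinearMap.one_def, ContinuousLinearMap.id_comp, sub_self]
    exact Submodule.zero_mem _
  | succ n ih =>
    have h1 : F - ((1 - h) ^ (n + 1)) ∘L F
        = (F - ((1 - h) ^ n) ∘L F) + ((1 - h) ^ n) ∘L (h ∘L F) := by
      ext x
      simp only [pow_succ, sub_apply, add_apply, ContinuousLinearMap.comp_apply,
        mul_apply_eq_comp, one_apply_eq_self, map_sub]
      abel
    rw [h1]
    exact Submodule.add_mem _ ih
      (adjointable_comp_mem_compactOperators (comp_mem_compactOperators hc hF)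
        (hh.one_sub.pow n).isAdjointable)

end Compact

/-! ### A compact operator with strongly vanishing powers of its complement -/

section StrictlyPositive

open Filter

variable {A : Type*} [NonUnitalCStarAlgebra A] [PartialOrder A] [StarOrderedRing A]
variable {N : Type*} [NormedAddCommGroup N] [NormedSpace ℂ N] [SMul Aᵐᵒᵖ N] [CStarModule Aᵐᵒᵖ N]

/-- As `‖tᵢ‖² ≤ 2⁻ⁱ⁻¹` sums to at most one, `∑ᵢ θ_{tᵢ,tᵢ}` is a positive contraction; it dominates
each of its terms. -/
theorem isPosContraction_of_hasSum_theta {t : ℕ → N} {h : N →L[ℂ] N}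
    (ht : ∀ i, ‖t i‖ ^ 2 ≤ 1 / 2 / 2 ^ i) (hs : HasSum (fun i => theta A (t i) (t i)) h) :
    IsPosContraction A h ∧
      ∀ i y, rightInner A y (t i) * rightInner A (t i) y ≤ rightInner A y (h y) := by
  have happ (x : N) : HasSum (fun i => theta A (t i) (t i) x) (h x) :=
    hs.mapL (ContinuousLinearMap.apply ℂ N x)
  have hr (y x : N) :
      HasSum (fun i => rightInner A y (t i) * rightInner A (t i) x) (rightInner A y (h x)) := by
    have h1 : Continuous fun z : N => rightInner A y z :=
      (continuous_rightInner A).comp (Continuous.prodMk_right y)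
    let g : N →+ A := AddMonoidHom.mk' (fun z => rightInner A y z) (rightInner_add A y)
    simpa [g, Function.comp_def, rightInner_theta] using (happ x).map g h1
  refine ⟨⟨fun x y => ?_, fun x => ?_, fun x => ?_⟩, fun i y => ?_⟩
  · have h1 := (hr y x).star
    simp only [star_mul, star_rightInner] at h1
    exact h1.unique (hr x y)
  · exact (hr x x).nonneg fun i => rightInner_mul_swap_nonneg A _ _
  · have h1 := (hasSum_geometric_two' 1).smul_const (rightInner A x x)
    rw [one_smul] at h1
    refine hasSum_le (fun i => ?_) (hr x x) h1
    exact (rightInner_mul_swap_le A x (t i)).trans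
      (smul_le_smul_of_nonneg_right (ht i) (rightInner_self_nonneg A x))
  · exact le_hasSum (hr y y) i fun j _ => rightInner_mul_swap_nonneg A _ _

/-- A countably generated Hilbert module carries an `A`-compact positive contraction `h` such that
`1 - (1 - h)ⁿ` tends strongly to the identity. -/
theorem IsCountablyGenerated.exists_isPosContraction [CompleteSpace N]
    (hN : IsCountablyGenerated A N) :
    ∃ h : N →L[ℂ] N, IsPosContraction A h ∧ h ∈ compactOperators A N N ∧
      ∀ x, Tendsto (fun n : ℕ => ((1 - h) ^ n) x) atTop (nhds 0) := by
  obtain ⟨S, hS, hd⟩ := hN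
  obtain ⟨s, hs⟩ := Set.countable_iff_exists_subset_range.1 hS
  -- `h = ∑ᵢ θ_{tᵢ,tᵢ}`, with the generators scaled so that `∑ᵢ ‖tᵢ‖² ≤ 1`
  set c : ℕ → ℝ := fun i => (1 / 2) ^ (i + 1) * (1 + ‖s i‖)⁻¹ with hc
  have hc0 (i : ℕ) : 0 < c i := by positivity
  set t : ℕ → N := fun i => (c i : ℂ) • s i with ht
  have htn (i : ℕ) : ‖t i‖ ≤ (1 / 2) ^ (i + 1) := by
    have h1 : (1 + ‖s i‖)⁻¹ * ‖s i‖ ≤ 1 := by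
      rw [inv_mul_le_iff₀ (by positivity)]; linarith
    simp only [ht, norm_smul, Complex.norm_real, Real.norm_of_nonneg (hc0 i).le]
    rw [hc, mul_assoc]
    exact mul_le_of_le_one_right (by positivity) h1
  have htn2 (i : ℕ) : ‖t i‖ ^ 2 ≤ 1 / 2 / 2 ^ i := by
    have h2 : ((1 : ℝ) / 2) ^ (i + 1) ≤ 1 := pow_le_one₀ (by norm_num) (by norm_num)
    have h3 : ((1 : ℝ) / 2) ^ (i + 1) = 1 / 2 / 2 ^ i := by
      rw [pow_succ, one_div_pow]; ring
    rw [← h3, pow_two]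
    exact (mul_le_of_le_one_right (norm_nonneg _) ((htn i).trans h2)).trans (htn i)
  have hsum : Summable fun i => theta A (t i) (t i) := by
    refine Summable.of_norm_bounded (summable_geometric_two' 1) fun i => ?_
    exact (norm_theta_le A _ _).trans ((pow_two _).symm.trans_le (htn2 i))
  obtain ⟨h, hh⟩ := hsum
  obtain ⟨hpos, hth⟩ := isPosContraction_of_hasSum_theta htn2 hh
  refine ⟨h, hpos, ?_, ?_⟩
  · exact isClosed_compactOperators.mem_of_tendsto hh
      (.of_forall fun u => Submodule.sum_mem _ fun i _ => theta_mem_compactOperators _ _)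
  · have hgen (i : ℕ) (a : A) : Tendsto (fun n : ℕ => ((1 - h) ^ n) (s i <• a)) atTop (nhds 0) := by
      have h1 := hpos.tendsto_one_sub_pow_apply (hth i)
      have h2 : Tendsto (fun n : ℕ => ((1 - h) ^ n) (s i)) atTop (nhds 0) := by
        have h3 := h1.const_smul ((c i : ℂ)⁻¹)
        have hci : (c i : ℂ) ≠ 0 := Complex.ofReal_ne_zero.2 (hc0 i).ne'
        simpa only [ht, map_smul, smul_smul, inv_mul_cancel₀ hci, one_smul, smul_zero] using h3
      refine squeeze_zero_norm (fun n => ?_)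
        (by simpa only [norm_zero, zero_mul] using h2.norm.mul_const ‖a‖)
      rw [(hpos.one_sub.pow n).isAdjointable.map_op_smul]
      exact norm_op_smul_le A _ _
    have hspan : ∀ z ∈ Submodule.span ℂ {z : N | ∃ s ∈ S, ∃ a : A, z = s <• a},
        Tendsto (fun n : ℕ => ((1 - h) ^ n) z) atTop (nhds 0) := fun z hz => by
      induction hz using Submodule.span_induction with
      | mem z hz =>
        obtain ⟨_, hs', a, rfl⟩ := hz
        obtain ⟨i, rfl⟩ := hs hs'
        exact hgen i a
      | zero => simp only [map_zero, tendsto_const_nhds]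
      | add x y _ _ hx hy => simpa only [map_add, add_zero] using hx.add hy
      | smul c x _ hx => simpa only [map_smul, smul_zero] using hx.const_smul c
    intro x
    rw [Metric.tendsto_atTop]
    intro ε hε
    obtain ⟨z, hz, hxz⟩ := Metric.mem_closure_iff.1 (hd x) (ε / 2) (half_pos hε)
    obtain ⟨n₀, hn₀⟩ := Metric.tendsto_atTop.1 (hspan z hz) (ε / 2) (half_pos hε)
    refine ⟨n₀, fun n hn => ?_⟩
    have h1 := hn₀ n hn
    rw [dist_zero_right] at h1 ⊢
    calc ‖((1 - h) ^ n) x‖ = ‖((1 - h) ^ n) (x - z) + ((1 - h) ^ n) z‖ := by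
          rw [map_sub, sub_add_cancel]
      _ ≤ ‖x - z‖ + ‖((1 - h) ^ n) z‖ :=
          (norm_add_le _ _).trans (by gcongr; exact (hpos.one_sub.pow n).norm_apply_le _)
      _ < ε / 2 + ε / 2 := add_lt_add (by rwa [← dist_eq_norm]) h1
      _ = ε := add_halves ε

end StrictlyPositive

/-! ### Admissible systems -/

section Admissible

open Filter

variable {A : Type*} [NonUnitalCStarAlgebra A] [PartialOrder A] [StarOrderedRing A]
variable {N : Type*} [NormedAddCommGroup N] [NormedSpace ℂ N] [SMul Aᵐᵒᵖ N] [CStarModule Aᵐᵒᵖ N]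

theorem IsState.sum_norm_sq_le {φ : A →L[ℂ] ℂ} (hφ : IsState φ) (X : ℕ → N) (s : Finset ℕ)
    (u : N) : ∑ i ∈ s, ‖φ (rightInner A u (X i))‖ ^ 2
      ≤ ‖∑ i ∈ s, rightInner A u (X i) * rightInner A (X i) u‖ := by
  calc ∑ i ∈ s, ‖φ (rightInner A u (X i))‖ ^ 2
      ≤ ∑ i ∈ s, (φ (rightInner A u (X i) * rightInner A (X i) u)).re :=
        Finset.sum_le_sum fun i _ => by
          simpa only [star_rightInner] using hφ.norm_sq_le (rightInner A u (X i))
    _ = (φ (∑ i ∈ s, rightInner A u (X i) * rightInner A (X i) u)).re := by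
        rw [map_sum, Complex.re_sum]
    _ ≤ _ := (Complex.re_le_norm _).trans (hφ.norm_apply_le _)

theorem IsAdmissible.sum_norm_sq_le {X : ℕ → N} (hX : IsAdmissible A X) {φ : A →L[ℂ] ℂ}
    (hφ : IsState φ) (s : Finset ℕ) (u : N) :
    ∑ i ∈ s, ‖φ (rightInner A u (X i))‖ ^ 2 ≤ ‖u‖ ^ 2 := by
  obtain ⟨n, hn⟩ := s.exists_nat_subset_range
  refine (Finset.sum_le_sum_of_subset_of_nonneg hn fun _ _ _ => sq_nonneg _).trans
    ((hφ.sum_norm_sq_le X _ u).trans ?_)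
  rw [norm_sq_eq_norm_rightInner A]
  exact CStarAlgebra.norm_le_norm_of_nonneg_of_le
    (Finset.sum_nonneg fun i _ => rightInner_mul_swap_nonneg A _ _) ((hX u).1 n)

theorem IsAdmissible.exists_norm_sum_Ico_le {X : ℕ → N} (hX : IsAdmissible A X) (x : N) {ε : ℝ}
    (hε : 0 < ε) :
    ∃ m : ℕ, ∀ k ≥ m, ∀ n,
      ‖∑ i ∈ Finset.Ico k n, rightInner A x (X i) * rightInner A (X i) x‖ ≤ ε := by
  obtain ⟨s, hs⟩ := (hX x).2
  obtain ⟨m, hm⟩ := Metric.cauchySeq_iff.1 hs.cauchySeq ε hε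
  refine ⟨m, fun k hk n => ?_⟩
  rcases le_total k n with hkn | hkn
  · rw [Finset.sum_Ico_eq_sub _ hkn, ← dist_eq_norm]
    exact (hm n (hk.trans hkn) k hk).le
  · rw [Finset.Ico_eq_empty_of_le hkn, Finset.sum_empty, norm_zero]
    exact hε.le

theorem IsAdmissible.tendsto_norm_rightInner {X : ℕ → N} (hX : IsAdmissible A X) (x : N) :
    Tendsto (fun i => ‖rightInner A x (X i)‖) atTop (nhds 0) := by
  rw [Metric.tendsto_atTop]
  intro ε hε
  obtain ⟨m, hm⟩ := hX.exists_norm_sum_Ico_le x (ε := (ε / 2) ^ 2) (by positivity)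
  refine ⟨m, fun i hi => ?_⟩
  have h := hm i hi (i + 1)
  rw [Nat.Ico_succ_singleton, Finset.sum_singleton, ← star_rightInner A x (X i),
    CStarRing.norm_self_mul_star, ← pow_two] at h
  rw [dist_zero_right, norm_norm]
  exact (abs_le_of_sq_le_sq' h (by positivity)).2.trans_lt (half_lt_self hε)

/-- Successive differences `qᵢ` of powers of a positive contraction, applied to vectors of norm at
most one, form an admissible system: `θ_{qᵢ yᵢ, qᵢ yᵢ} ≤ qᵢ² ≤ qᵢ`, and the `qᵢ` telescope. -/
theorem IsPosContraction.isAdmissible_pow_sub_pow {r : N →L[ℂ] N} (hr : IsPosContraction A r)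
    (hlim : ∀ x, Tendsto (fun n : ℕ => (r ^ n) x) atTop (nhds 0)) {ν : ℕ → ℕ} (hν : StrictMono ν)
    {y : ℕ → N} (hy : ∀ i, ‖y i‖ ≤ 1) :
    IsAdmissible A fun i => (r ^ ν i - r ^ ν (i + 1)) (y i) := by
  intro x
  set b : ℕ → A := fun i => rightInner A x ((r ^ ν i) x) with hb
  set X : ℕ → N := fun i => (r ^ ν i - r ^ ν (i + 1)) (y i) with hX
  have hb0 (i : ℕ) : 0 ≤ b i := (hr.pow _).nonneg x
  have hterm (i : ℕ) : rightInner A x (X i) * rightInner A (X i) x ≤ b i - b (i + 1) := by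
    have hq := hr.pow_sub_pow (hν.monotone (Nat.le_succ i))
    have h1 := rightInner_mul_swap_le A ((r ^ ν i - r ^ ν (i + 1)) x) (y i)
    rw [hq.symm, ← hq.symm (y i)] at h1
    refine h1.trans ?_
    calc _ ≤ (1 : ℝ) • rightInner A ((r ^ ν i - r ^ ν (i + 1)) x) ((r ^ ν i - r ^ ν (i + 1)) x) :=
          smul_le_smul_of_nonneg_right (pow_le_one₀ (norm_nonneg _) (hy i))
            (rightInner_self_nonneg A _)
      _ ≤ rightInner A x ((r ^ ν i - r ^ ν (i + 1)) x) := by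
          rw [one_smul]; exact hq.rightInner_apply_self_le x
      _ = b i - b (i + 1) := by rw [sub_apply, rightInner_sub]
  have hIco (m n : ℕ) (hmn : m ≤ n) :
      ∑ i ∈ Finset.Ico m n, rightInner A x (X i) * rightInner A (X i) x ≤ b m := by
    refine (Finset.sum_le_sum fun i _ => hterm i).trans ?_
    have h1 := Finset.sum_Ico_sub b hmn
    have h2 : ∑ i ∈ Finset.Ico m n, (b i - b (i + 1)) = b m - b n := by
      rw [← neg_sub (b n), ← h1, ← Finset.sum_neg_distrib]
      simp only [neg_sub]
    rw [h2]
    exact sub_le_self _ (hb0 n)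
  refine ⟨fun n => ?_, ?_⟩
  · rw [Finset.range_eq_Ico]
    exact (hIco 0 n n.zero_le).trans ((hr.pow _).le x)
  · have hb1 : Tendsto (fun i => ‖b i‖) atTop (nhds 0) := by
      refine squeeze_zero (fun i => norm_nonneg _) (fun i => norm_rightInner_le A x _) ?_
      simpa only [norm_zero, mul_zero, Function.comp_def] using
        ((hlim x).comp hν.tendsto_atTop).norm.const_mul ‖x‖
    refine cauchySeq_tendsto_of_complete (cauchySeq_of_le_tendsto_0' _ (fun m n hmn => ?_) hb1)
    rw [dist_comm, dist_eq_norm, ← Finset.sum_Ico_eq_sub _ hmn]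
    exact CStarAlgebra.norm_le_norm_of_nonneg_of_le
      (Finset.sum_nonneg fun i _ => rightInner_mul_swap_nonneg A _ _) (hIco m n hmn)

end Admissible

/-! ### Estimates for the pseudo-metrics -/

section PseudoDist

variable {A : Type*} [NonUnitalCStarAlgebra A] [PartialOrder A] [StarOrderedRing A]
variable {N : Type*} [NormedAddCommGroup N] [NormedSpace ℂ N] [SMul Aᵐᵒᵖ N] [CStarModule Aᵐᵒᵖ N]

theorem pseudoDist_le_of_sum_Ico_le {X : ℕ → N} {Φ : ℕ → A →L[ℂ] ℂ} {x y : N} {c : ℝ}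
    (h : ∀ k n, ∑ i ∈ Finset.Ico k n, ‖Φ k (rightInner A (x - y) (X i))‖ ^ 2 ≤ c) :
    pseudoDist X Φ x y ≤ ENNReal.ofReal (√c) := by
  rw [pseudoDist, Real.sqrt_eq_rpow, ← ENNReal.ofReal_rpow_of_nonneg (by simpa using h 0 0)
    (by norm_num)]
  refine ENNReal.rpow_le_rpow (iSup_le fun k => ?_) (by norm_num)
  rw [ENNReal.tsum_eq_iSup_sum]
  refine iSup_le fun s => ?_
  obtain ⟨n, hn⟩ := (s.map (Function.Embedding.subtype fun i => k ≤ i)).exists_nat_subset_range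
  have hsub : s.map (Function.Embedding.subtype fun i => k ≤ i) ⊆ Finset.Ico k n := fun i hi => by
    refine Finset.mem_Ico.2 ⟨?_, Finset.mem_range.1 (hn hi)⟩
    obtain ⟨j, -, rfl⟩ := Finset.mem_map.1 hi
    exact j.2
  calc ∑ i ∈ s, ‖Φ k (rightInner A (x - y) (X i))‖ₑ ^ 2
      = ∑ i ∈ s.map (Function.Embedding.subtype fun i => k ≤ i),
          ‖Φ k (rightInner A (x - y) (X i))‖ₑ ^ 2 := by rw [Finset.sum_map]; rfl
    _ ≤ ∑ i ∈ Finset.Ico k n, ‖Φ k (rightInner A (x - y) (X i))‖ₑ ^ 2 :=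
        Finset.sum_le_sum_of_subset hsub
    _ = ENNReal.ofReal (∑ i ∈ Finset.Ico k n, ‖Φ k (rightInner A (x - y) (X i))‖ ^ 2) := by
        rw [ENNReal.ofReal_sum_of_nonneg fun i _ => sq_nonneg _]
        refine Finset.sum_congr rfl fun i _ => ?_
        rw [ENNReal.ofReal_pow (norm_nonneg _), ofReal_norm]
    _ ≤ ENNReal.ofReal c := ENNReal.ofReal_le_ofReal (h k n)

theorem norm_apply_rightInner_lt_of_pseudoDist_lt {X : ℕ → N} {Φ : ℕ → A →L[ℂ] ℂ} {x y : N}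
    {ε : ℝ} (h : pseudoDist X Φ x y < ENNReal.ofReal ε) (k : ℕ) :
    ‖Φ k (rightInner A (x - y) (X k))‖ < ε := by
  have h1 : ‖Φ k (rightInner A (x - y) (X k))‖ₑ ≤ pseudoDist X Φ x y := by
    have h2 : ‖Φ k (rightInner A (x - y) (X k))‖ₑ ^ 2
        ≤ ⨆ k : ℕ, ∑' i : {i : ℕ // k ≤ i}, ‖Φ k (rightInner A (x - y) (X i))‖ₑ ^ 2 :=
      (ENNReal.le_tsum (f := fun i : {i : ℕ // k ≤ i} =>
        ‖Φ k (rightInner A (x - y) (X i))‖ₑ ^ 2) ⟨k, le_rfl⟩).trans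
        (le_iSup (fun k : ℕ => ∑' i : {i : ℕ // k ≤ i},
          ‖Φ k (rightInner A (x - y) (X i))‖ₑ ^ 2) k)
    have h3 := ENNReal.rpow_le_rpow h2 (z := 1 / 2) (by norm_num)
    rwa [← ENNReal.rpow_natCast, ← ENNReal.rpow_mul, Nat.cast_two, mul_one_div_cancel two_ne_zero,
      ENNReal.rpow_one] at h3
  have h2 := h1.trans_lt h
  rw [← ofReal_norm] at h2
  exact (ENNReal.ofReal_lt_ofReal_iff_of_nonneg (norm_nonneg _)).1 h2

end PseudoDist

/-! ### Operators with uniform tails -/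

section UniformTails

variable {A : Type*} [NonUnitalCStarAlgebra A] [PartialOrder A] [StarOrderedRing A]
variable {M N : Type*} [NormedAddCommGroup M] [NormedSpace ℂ M] [SMul Aᵐᵒᵖ M] [CStarModule Aᵐᵒᵖ M]
  [NormedAddCommGroup N] [NormedSpace ℂ N] [SMul Aᵐᵒᵖ N] [CStarModule Aᵐᵒᵖ N]

theorem norm_apply_rightInner_add_sq_le (φ : A →L[ℂ] ℂ) (x y z : N) :
    ‖φ (rightInner A (x + y) z)‖ ^ 2
      ≤ 2 * ‖φ (rightInner A x z)‖ ^ 2 + 2 * ‖φ (rightInner A y z)‖ ^ 2 := by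
  rw [rightInner_add_left, map_add]
  have h := norm_add_le (φ (rightInner A x z)) (φ (rightInner A y z))
  have h1 := pow_le_pow_left₀ (norm_nonneg _) h 2
  nlinarith [sq_nonneg (‖φ (rightInner A x z)‖ - ‖φ (rightInner A y z)‖)]

theorem sum_norm_apply_rightInner_add_sq_le (φ : A →L[ℂ] ℂ) (X : ℕ → N) (s : Finset ℕ) (x y : N) :
    ∑ i ∈ s, ‖φ (rightInner A (x + y) (X i))‖ ^ 2
      ≤ 2 * ∑ i ∈ s, ‖φ (rightInner A x (X i))‖ ^ 2
        + 2 * ∑ i ∈ s, ‖φ (rightInner A y (X i))‖ ^ 2 := by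
  rw [Finset.mul_sum, Finset.mul_sum, ← Finset.sum_add_distrib]
  exact Finset.sum_le_sum fun i _ => norm_apply_rightInner_add_sq_le φ x y (X i)

variable (A M) in
/-- The operators `T` for which the tails of `∑ᵢ |φ(⟨T z, xᵢ⟩)|²` are small, uniformly in the state
`φ` and in `z` in the unit ball. -/
def uniformTailOperators (X : ℕ → N) : Submodule ℂ (M →L[ℂ] N) where
  carrier := {T | ∀ ε : ℝ, 0 < ε → ∃ m : ℕ, ∀ φ : A →L[ℂ] ℂ, IsState φ → ∀ z : M, ‖z‖ ≤ 1 →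
    ∀ n, ∑ i ∈ Finset.Ico m n, ‖φ (rightInner A (T z) (X i))‖ ^ 2 ≤ ε}
  zero_mem' ε hε := ⟨0, fun φ _ z _ n => by simp [rightInner, hε.le]⟩
  add_mem' {S T} hS hT ε hε := by
    obtain ⟨m₁, h₁⟩ := hS (ε / 4) (by positivity)
    obtain ⟨m₂, h₂⟩ := hT (ε / 4) (by positivity)
    refine ⟨max m₁ m₂, fun φ hφ z hz n => ?_⟩
    have h3 := sum_norm_apply_rightInner_add_sq_le φ X (Finset.Ico (max m₁ m₂) n) (S z) (T z)
    have h4 := (Finset.sum_le_sum_of_subset_of_nonneg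
      (Finset.Ico_subset_Ico_left (le_max_left m₁ m₂)) fun _ _ _ => sq_nonneg _).trans
        (h₁ φ hφ z hz n)
    have h5 := (Finset.sum_le_sum_of_subset_of_nonneg
      (Finset.Ico_subset_Ico_left (le_max_right m₁ m₂)) fun _ _ _ => sq_nonneg _).trans
        (h₂ φ hφ z hz n)
    rw [add_apply]
    linarith
  smul_mem' c T hT ε hε := by
    obtain ⟨m, hm⟩ := hT (ε / (‖c‖ ^ 2 + 1)) (by positivity)
    refine ⟨m, fun φ hφ z hz n => ?_⟩
    have h1 := hm φ hφ z hz n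
    rw [le_div_iff₀ (by positivity)] at h1
    have h2 : 0 ≤ ∑ i ∈ Finset.Ico m n, ‖φ (rightInner A (T z) (X i))‖ ^ 2 :=
      Finset.sum_nonneg fun _ _ => sq_nonneg _
    simp only [smul_apply, rightInner_smul_left, map_smul, norm_smul, norm_star, mul_pow,
      ← Finset.mul_sum]
    linarith

theorem mem_uniformTailOperators {X : ℕ → N} {T : M →L[ℂ] N} :
    T ∈ uniformTailOperators A M X ↔ ∀ ε : ℝ, 0 < ε → ∃ m : ℕ, ∀ φ : A →L[ℂ] ℂ, IsState φ →
      ∀ z : M, ‖z‖ ≤ 1 → ∀ n, ∑ i ∈ Finset.Ico m n, ‖φ (rightInner A (T z) (X i))‖ ^ 2 ≤ ε :=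
  Iff.rfl

theorem isClosed_uniformTailOperators {X : ℕ → N} (hX : IsAdmissible A X) :
    IsClosed (uniformTailOperators A M X : Set (M →L[ℂ] N)) := by
  refine isClosed_of_closure_subset fun T hT => mem_uniformTailOperators.2 fun ε hε => ?_
  obtain ⟨S, hS, hTS⟩ := Metric.mem_closure_iff.1 hT (√(ε / 4)) (by positivity)
  obtain ⟨m, hm⟩ := mem_uniformTailOperators.1 hS (ε / 4) (by positivity)
  refine ⟨m, fun φ hφ z hz n => ?_⟩
  have h1 := sum_norm_apply_rightInner_add_sq_le φ X (Finset.Ico m n) ((T - S) z) (S z)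
  have h2 := hX.sum_norm_sq_le hφ (Finset.Ico m n) ((T - S) z)
  have h3 : ‖(T - S) z‖ ^ 2 ≤ ε / 4 := by
    rw [dist_eq_norm] at hTS
    have h4 : ‖(T - S) z‖ ≤ √(ε / 4) :=
      ((T - S).le_opNorm_of_le hz).trans ((mul_one _).trans_le hTS.le)
    exact (pow_le_pow_left₀ (norm_nonneg _) h4 2).trans_eq (Real.sq_sqrt (by positivity))
  have h4 := hm φ hφ z hz n
  rw [sub_apply, sub_add_cancel] at h1
  rw [sub_apply] at h2 h3
  linarith

theorem theta_mem_uniformTailOperators {X : ℕ → N} (hX : IsAdmissible A X) (x : N) (y : M) :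
    theta A x y ∈ uniformTailOperators A M X := by
  refine mem_uniformTailOperators.2 fun ε hε => ?_
  obtain ⟨m, hm⟩ := hX.exists_norm_sum_Ico_le x (ε := ε / (‖y‖ ^ 2 + 1)) (by positivity)
  refine ⟨m, fun φ hφ z hz n => (hφ.sum_norm_sq_le X _ _).trans ?_⟩
  set a := rightInner A y z with ha
  have han : ‖a‖ ≤ ‖y‖ :=
    (norm_rightInner_le A y z).trans (mul_le_of_le_one_right (norm_nonneg _) hz)
  have h1 : ∑ i ∈ Finset.Ico m n,
        rightInner A (theta A x y z) (X i) * rightInner A (X i) (theta A x y z)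
      = star a * (∑ i ∈ Finset.Ico m n, rightInner A x (X i) * rightInner A (X i) x) * a := by
    rw [Finset.mul_sum, Finset.sum_mul]
    refine Finset.sum_congr rfl fun i _ => ?_
    rw [theta_apply, rightInner_op_smul, rightInner_op_smul_left]
    simp only [mul_assoc, ha]
  have h2 := hm m le_rfl n
  rw [le_div_iff₀ (by positivity)] at h2
  set b := ∑ i ∈ Finset.Ico m n, rightInner A x (X i) * rightInner A (X i) x
  rw [h1]
  calc ‖star a * b * a‖ ≤ ‖star a‖ * ‖b‖ * ‖a‖ :=
        (norm_mul_le _ _).trans (by gcongr; exact norm_mul_le _ _)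
    _ = ‖b‖ * ‖a‖ ^ 2 := by rw [norm_star]; ring
    _ ≤ ‖b‖ * (‖y‖ ^ 2 + 1) := by
        gcongr
        exact (pow_le_pow_left₀ (norm_nonneg _) han 2).trans (by linarith)
    _ ≤ ε := h2

end UniformTails

/-! ### Compactness and total boundedness -/

section Equivalence

open Filter

variable {A : Type*} [NonUnitalCStarAlgebra A] [PartialOrder A] [StarOrderedRing A]
variable {M N : Type*} [NormedAddCommGroup M] [NormedSpace ℂ M] [SMul Aᵐᵒᵖ M] [CStarModule Aᵐᵒᵖ M]
  [NormedAddCommGroup N] [NormedSpace ℂ N] [SMul Aᵐᵒᵖ N] [CStarModule Aᵐᵒᵖ N]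

/-- A bounded set has finite nets for any finite number of the functionals
`u ↦ φₖ(⟨u, xᵢ⟩)`. -/
theorem exists_finite_net_apply_rightInner {X : ℕ → N} (hX : IsAdmissible A X)
    {Φ : ℕ → A →L[ℂ] ℂ} (hΦ : ∀ k, IsState (Φ k)) {Y : Set N} {R : ℝ} (hY : ∀ y ∈ Y, ‖y‖ ≤ R)
    (m : ℕ) {η : ℝ} (hη : 0 < η) :
    ∃ T ⊆ Y, T.Finite ∧ ∀ y ∈ Y, ∃ t ∈ T, ∀ k < m, ∀ i < m,
      ‖Φ k (rightInner A (t - y) (X i))‖ ≤ η := by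
  let g : N → Fin m → Fin m → ℂ := fun u k i => Φ k (rightInner A u (X i))
  have hb : TotallyBounded (g '' Y) := by
    refine (isCompact_closedBall (0 : Fin m → Fin m → ℂ) (max R 0)).totallyBounded.subset ?_
    rintro _ ⟨y, hy, rfl⟩
    rw [mem_closedBall_zero_iff]
    refine (pi_norm_le_iff_of_nonneg (le_max_right _ _)).2 fun k =>
      (pi_norm_le_iff_of_nonneg (le_max_right _ _)).2 fun i => ?_
    have h := hX.sum_norm_sq_le (hΦ k) {(i : ℕ)} y
    rw [Finset.sum_singleton] at h
    exact ((abs_le_of_sq_le_sq' h (norm_nonneg _)).2.trans (hY y hy)).trans (le_max_left _ _)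
  obtain ⟨T, hTY, hT, hcov⟩ := Set.exists_subset_image_finite_and.1
    (Metric.finite_approx_of_totallyBounded hb η hη)
  refine ⟨T, hTY, hT, fun y hy => ?_⟩
  obtain ⟨_, ⟨t, ht, rfl⟩, hty⟩ := Set.mem_iUnion₂.1 (hcov (Set.mem_image_of_mem g hy))
  refine ⟨t, ht, fun k hk i hi => ?_⟩
  have h1 : ‖g t - g y‖ < η := by rwa [← dist_eq_norm, ← Metric.mem_ball']
  have h2 := ((norm_le_pi_norm _ _).trans (norm_le_pi_norm (g t - g y) ⟨k, hk⟩)).trans h1.le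
    (a := ‖(g t - g y) ⟨k, hk⟩ ⟨i, hi⟩‖)
  simpa [g, rightInner_sub_left] using h2

/-- Uniform tails reduce total boundedness to finitely many coordinates `φₖ(⟨·, xᵢ⟩)`: those with
`i ≥ m` are negligible, and those with `k ≥ m` only involve `i ≥ k ≥ m`. -/
theorem isTotallyBounded_image_of_isACompact {F : M →L[ℂ] N} (hF : IsACompact A F) :
    IsTotallyBounded A (F '' Metric.closedBall (0 : M) 1) := by
  intro X Φ hX hΦ ε hε
  have hmem : F ∈ uniformTailOperators A M X :=
    compactOperators_le (isClosed_uniformTailOperators hX)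
      (fun x y => theta_mem_uniformTailOperators hX x y) (mem_compactOperators.2 hF)
  obtain ⟨m, hm⟩ := mem_uniformTailOperators.1 hmem (ε ^ 2 / 16) (by positivity)
  have hη : 0 < ε / (2 * (m + 1)) := by positivity
  have hbdd : ∀ y ∈ F '' Metric.closedBall (0 : M) 1, ‖y‖ ≤ ‖F‖ := by
    rintro _ ⟨z, hz, rfl⟩
    exact (F.le_opNorm_of_le (mem_closedBall_zero_iff.1 hz)).trans_eq (mul_one _)
  obtain ⟨T, hTY, hT, hnet⟩ := exists_finite_net_apply_rightInner hX hΦ hbdd m hη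
  refine ⟨T, hT, hTY, fun y hy => ?_⟩
  obtain ⟨t, ht, hty⟩ := hnet y hy
  refine ⟨t, ht, ?_⟩
  obtain ⟨w, hw, rfl⟩ := hy
  obtain ⟨z, hz, rfl⟩ := hTY ht
  rw [mem_closedBall_zero_iff] at hw hz
  refine (pseudoDist_le_of_sum_Ico_le (c := ε ^ 2 / 2) fun k n => ?_).trans_lt ?_
  · have hhead : ∑ i ∈ (Finset.Ico k n).filter (· < m),
        ‖Φ k (rightInner A (F z - F w) (X i))‖ ^ 2 ≤ ε ^ 2 / 4 := by
      calc _ ≤ ∑ i ∈ (Finset.Ico k n).filter (· < m), (ε / (2 * (m + 1))) ^ 2 := by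
            refine Finset.sum_le_sum fun i hi => ?_
            obtain ⟨hi1, hi2⟩ := Finset.mem_filter.1 hi
            exact pow_le_pow_left₀ (norm_nonneg _)
              (hty k ((Finset.mem_Ico.1 hi1).1.trans_lt hi2) i hi2) 2
        _ ≤ ∑ i ∈ Finset.range m, (ε / (2 * (m + 1))) ^ 2 :=
            Finset.sum_le_sum_of_subset_of_nonneg
              (fun i hi => Finset.mem_range.2 (Finset.mem_filter.1 hi).2) fun _ _ _ => sq_nonneg _
        _ = (m / (m + 1) ^ 2) * (ε ^ 2 / 4) := by
            rw [Finset.sum_const, Finset.card_range, nsmul_eq_mul]; field_simp; ring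
        _ ≤ 1 * (ε ^ 2 / 4) := by
            gcongr
            rw [div_le_one (by positivity)]
            nlinarith [(m.cast_nonneg : (0 : ℝ) ≤ m)]
        _ = ε ^ 2 / 4 := one_mul _
    have htail : ∑ i ∈ (Finset.Ico k n).filter (¬ · < m),
        ‖Φ k (rightInner A (F z - F w) (X i))‖ ^ 2 ≤ ε ^ 2 / 4 := by
      have h1 := sum_norm_apply_rightInner_add_sq_le (Φ k) X (Finset.Ico m n) (F z) (F (-w))
      have h2 := hm (Φ k) (hΦ k) z hz n
      have h3 := hm (Φ k) (hΦ k) (-w) (by rwa [norm_neg]) n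
      rw [map_neg, ← sub_eq_add_neg] at h1
      rw [map_neg] at h3
      refine (Finset.sum_le_sum_of_subset_of_nonneg (fun i hi => ?_)
        fun _ _ _ => sq_nonneg _).trans (h1.trans (by linarith))
      obtain ⟨hi1, hi2⟩ := Finset.mem_filter.1 hi
      exact Finset.mem_Ico.2 ⟨not_lt.1 hi2, (Finset.mem_Ico.1 hi1).2⟩
    rw [← Finset.sum_filter_add_sum_filter_not _ (· < m)]
    linarith
  · rw [ENNReal.ofReal_lt_ofReal_iff hε, Real.sqrt_lt' hε]
    have := sq_pos_of_pos hε
    linarith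

/-- If `F` is not `A`-compact and `r = 1 - h` with `h` an `A`-compact positive contraction whose
powers `rⁿ` tend strongly to zero, then blocks `rⁿ - rᵐ` arbitrarily far out are seen by the image
of the unit ball. -/
theorem exists_le_norm_rightInner_pow_sub_pow {h : N →L[ℂ] N} (hh : IsPosContraction A h)
    (hc : h ∈ compactOperators A N N)
    (hlim : ∀ x, Tendsto (fun n : ℕ => ((1 - h) ^ n) x) atTop (nhds 0))
    {F : M →L[ℂ] N} (hF : IsAdjointable A F) (hFc : F ∉ compactOperators A M N) :
    ∃ δ : ℝ, 0 < δ ∧ ∀ n : ℕ, ∃ m > n, ∃ z : M, ‖z‖ ≤ 1 ∧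
      δ ≤ ‖rightInner A (F z) (((1 - h) ^ n - (1 - h) ^ m) (F z))‖ := by
  set r := 1 - h
  have hr : IsPosContraction A r := hh.one_sub
  obtain ⟨ε, hε, hdist⟩ := Metric.isOpen_iff.1 isClosed_compactOperators.isOpen_compl F hFc
  refine ⟨ε ^ 2 / 8, by positivity, fun n => ?_⟩
  have hn : ε ≤ ‖(r ^ n) ∘L F‖ := by
    by_contra! hlt
    refine hdist (Metric.mem_ball.2 ?_) (sub_one_sub_pow_comp_mem hh hc hF n)
    rwa [dist_eq_norm, sub_sub_cancel_left, norm_neg]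
  obtain ⟨z, hz, hzn⟩ := ((r ^ n) ∘L F).exists_lt_apply_of_lt_opNorm ((half_lt_self hε).trans_le hn)
  rw [ContinuousLinearMap.comp_apply] at hzn
  have h1 : ε ^ 2 / 8 < ‖rightInner A (F z) ((r ^ n) (F z))‖ := by
    have h2 := CStarAlgebra.norm_le_norm_of_nonneg_of_le (rightInner_self_nonneg A _)
      ((hr.pow n).rightInner_apply_self_le (F z))
    rw [← norm_sq_eq_norm_rightInner A] at h2
    have h3 := pow_le_pow_left₀ (by positivity) hzn.le 2
    have h4 := sq_pos_of_pos hε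
    linarith [div_pow ε 2 2]
  have h2 : Tendsto (fun m : ℕ => ‖rightInner A (F z) ((r ^ n - r ^ m) (F z))‖) atTop
      (nhds ‖rightInner A (F z) ((r ^ n) (F z))‖) := by
    have hcont : Continuous fun u : N => rightInner A (F z) u :=
      (continuous_rightInner A).comp (Continuous.prodMk_right (F z))
    have h3 := (hlim (F z)).const_sub ((r ^ n) (F z))
    rw [sub_zero] at h3
    exact ((hcont.tendsto _).comp h3).norm
  obtain ⟨m, hm, hmn⟩ := ((h2.eventually_const_lt h1).and (eventually_gt_atTop n)).exists
  exact ⟨m, hmn, z, hz.le, hm.le⟩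

/-- The admissible system and the states that witness the failure of total boundedness for an
operator that is not `A`-compact. -/
theorem exists_isAdmissible_of_not_mem_compactOperators [CompleteSpace N]
    (hN : IsCountablyGenerated A N) {F : M →L[ℂ] N} (hF : IsAdjointable A F)
    (hFc : F ∉ compactOperators A M N) :
    ∃ (X : ℕ → N) (Φ : ℕ → A →L[ℂ] ℂ) (z : ℕ → M) (c : ℝ), IsAdmissible A X ∧
      (∀ k, IsState (Φ k)) ∧ (∀ i, ‖z i‖ ≤ 1) ∧ 0 < c ∧
      ∀ i, c ≤ ‖Φ i (rightInner A (F (z i)) (X i))‖ := by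
  obtain ⟨h, hh, hc, hlim⟩ := hN.exists_isPosContraction
  obtain ⟨δ, hδ, hblock⟩ := exists_le_norm_rightInner_pow_sub_pow hh hc hlim hF hFc
  set r := 1 - h
  have hr : IsPosContraction A r := hh.one_sub
  choose next hnext z hz hδz using hblock
  let ν : ℕ → ℕ := fun i => next^[i] 0
  have hν1 (i : ℕ) : ν (i + 1) = next (ν i) := Function.iterate_succ_apply' next i 0
  have hν : StrictMono ν := strictMono_nat_of_lt_succ fun i => by rw [hν1]; exact hnext _
  set q : ℕ → N →L[ℂ] N := fun i => r ^ ν i - r ^ ν (i + 1) with hq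
  have hqδ (i : ℕ) : δ ≤ ‖rightInner A (F (z (ν i))) (q i (F (z (ν i))))‖ := by
    simp only [hq, hν1]; exact hδz (ν i)
  -- `⟨y, qᵢ y⟩` is positive, so a state attains its norm
  have hstate (i : ℕ) : ∃ φ : A →L[ℂ] ℂ, IsState φ ∧
      φ (rightInner A (F (z (ν i))) (q i (F (z (ν i)))))
        = ‖rightInner A (F (z (ν i))) (q i (F (z (ν i))))‖ :=
    exists_isState_apply_eq_norm ((hr.pow_sub_pow (hν.monotone i.le_succ)).nonneg _)
      (norm_pos_iff.1 (hδ.trans_le (hqδ i)))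
  choose Φ hΦ hΦq using hstate
  set R : ℝ := ‖F‖ + 1
  have hR : 0 < R := by positivity
  refine ⟨fun i => q i (((R⁻¹ : ℝ) : ℂ) • F (z (ν i))), Φ, fun i => z (ν i), R⁻¹ * δ,
    hr.isAdmissible_pow_sub_pow hlim hν fun i => ?_, hΦ, fun i => hz _, by positivity, fun i => ?_⟩
  · rw [norm_smul, Complex.norm_real, Real.norm_of_nonneg (by positivity),
      inv_mul_le_iff₀ hR, mul_one]
    exact ((F.le_opNorm_of_le (hz _)).trans_eq (mul_one _)).trans (by simp [R])
  · dsimp only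
    rw [map_smul, rightInner_smul, map_smul, hΦq, norm_smul, Complex.norm_real, Complex.norm_real,
      norm_norm, Real.norm_of_nonneg (by positivity)]
    gcongr
    exact hqδ i

/-- A finite net cannot serve the vectors `F zᵢ` found above: `⟨t, xᵢ⟩ → 0` for each of its members
`t`, while the diagonal terms `φᵢ(⟨F zᵢ, xᵢ⟩)` stay away from zero. -/
theorem isACompact_of_isTotallyBounded_image [CompleteSpace N] (hN : IsCountablyGenerated A N)
    {F : M →L[ℂ] N} (hF : IsAdjointable A F)
    (hT : IsTotallyBounded A (F '' Metric.closedBall (0 : M) 1)) : IsACompact A F := by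
  by_contra hFc
  obtain ⟨X, Φ, z, c, hX, hΦ, hz, hc, hcz⟩ :=
    exists_isAdmissible_of_not_mem_compactOperators hN hF hFc
  obtain ⟨T, hTfin, -, hnet⟩ := hT X Φ hX hΦ (c / 2) (half_pos hc)
  have hev : ∀ᶠ i in atTop, ∀ t ∈ T, ‖rightInner A t (X i)‖ < c / 2 :=
    (eventually_all_finite hTfin).2 fun t _ =>
      (hX.tendsto_norm_rightInner t).eventually_lt_const (half_pos hc)
  obtain ⟨i, hi⟩ := hev.exists
  obtain ⟨t, ht, hti⟩ := hnet (F (z i))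
    (Set.mem_image_of_mem F (mem_closedBall_zero_iff.2 (hz i)))
  have h1 := norm_apply_rightInner_lt_of_pseudoDist_lt hti i
  have h2 := ((hΦ i).norm_apply_le _).trans_lt (hi t ht)
  have h3 := norm_sub_le (Φ i (rightInner A t (X i))) (Φ i (rightInner A (t - F (z i)) (X i)))
  rw [← map_sub, rightInner_sub_left, sub_sub_cancel, ← rightInner_sub_left] at h3
  linarith [hcz i]

end Equivalence

end HilbertCStar

theorem theorem2 {A : Type*} [NonUnitalCStarAlgebra A] [PartialOrder A] [StarOrderedRing A]
    {M : Type*} [NormedAddCommGroup M] [NormedSpace ℂ M] [CompleteSpace M]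
    [SMul Aᵐᵒᵖ M] [CStarModule Aᵐᵒᵖ M]
    {N : Type*} [NormedAddCommGroup N] [NormedSpace ℂ N] [CompleteSpace N]
    [SMul Aᵐᵒᵖ N] [CStarModule Aᵐᵒᵖ N]
    (hN : IsCountablyGenerated A N) (F : M →L[ℂ] N) (hF : IsAdjointable A F) :
    IsACompact A F ↔ IsTotallyBounded A (F '' Metric.closedBall (0 : M) 1) :=
  ⟨isTotallyBounded_image_of_isACompact, isACompact_of_isTotallyBounded_image hN hF⟩
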